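/- **Setting.** Let $T\in[1,+\infty]$ be the random running time of a Las Vegas algorithm, with probability distribution $p$ on $[1,+\infty]$. For a (possibly random) sequence of cutoff times $S=(S_k)_{k\ge 0}\in[1,\infty)^{\mathbb N}$, let $T_0,T_1,\dots$ be i.i.d. with law $p$ and independent of $S$, let $K^\star=\min\{k\ge 0: T_k\le S_k\}$, and let $$\ell_p(S)=\mathbb E\Big[\sum_{k=0}^{K^\star-1}S_k+T_{K^\star}\Big]$$ be the expected running time of the algorithm restarted with cutoffs $S$ (if $K^\star=+\infty$, the quantity inside the expectation is $\sum_{k\ge0} S_k=+\infty$). The *parallel restart strategy* $S^{\mathrm{PRS}}$ is the following random cutoff sequence. Counters $K_i$, $i\in\mathbb N=\{0,1,2,\dots\}$, start at $0$. In each round an index $I\in\mathbb N$ is sampled, conditionally on the previous rounds, with probability proportional to $$\frac{\big(1-2^{-(i+2)}\big)^{K_i}}{1+i\log_2^2 i}\qquad(\text{with } 0\cdot\log_2^2 0=0);$$ the cutoff of this round is $\big(1-2^{-(I+2)}\big)^{-K_I}$, and then $K_I$ is increased by $1$. For a strictly increasing continuous $\phi:[1,+\infty)\to[0,+\infty)$,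 extended by $\phi(+\infty)=\lim_{t\to+\infty}\phi(t)\in[0,+\infty]$, put $\mu_\phi(T)=\phi^{-1}(\mathbb E[\phi(T)])\in[1,+\infty]$. **Theorem.** Let $\phi:[1,+\infty)\to[0,+\infty)$ be concave, strictly increasing and twice differentiable (one-sidedly at $1$), with $$\liminf_{t\to+\infty}\frac{t\,\phi''(t)}{\phi'(t)}>-2 .$$ Then there is a constant $C_\phi>0$, depending only on $\phi$, such that for every probability distribution $p$ on $[1,+\infty]$, $$\ell_p(S^{\mathrm{PRS}})\le C_\phi\,\mu_\phi(T).$$ In particular, there is a universal constant $C>0$ such that for every $p$ $$\ell_p(S^{\mathrm{PRS}})\le C\,e^{\mathbb E[\ln T]},$$ and for every real $a>-1$ with $a\ne0$ there is a constant $C_a>0$ such that for every $p$ $$\ell_p(S^{\mathrm{PRS}})\le C_a\,\mathbb E[T^a]^{1/a}$$ (with values in $[1,+\infty]$ and the conventions $\ln(+\infty)=+\infty$; for $a>0$, $(+\infty)^a=(+\infty)^{1/a}=+\infty$; for $a<0$, $(+\infty)^a=0$ and $0^{1/a}=+\infty$). -/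

import Mathlib

open MeasureTheory ProbabilityTheory
open scoped ENNReal NNReal

noncomputable section

namespace Restart

/-! ### Multi-start algorithms and their expected running time -/

open Classical in
/-- Running time of the multi-start algorithm whose `k`-th run has cutoff `S k` and would need
time `T k` to terminate: if `K` is the first index with `T K ≤ S K`, it is
`S 0 + ⋯ + S (K - 1) + T K`. If no run terminates before its cutoff, it is the sum of
all cutoffs. -/
def runTime (S : ℕ → ℝ) (T : ℕ → ℝ≥0∞) : ℝ≥0∞ :=
  if h : ∃ k, T k ≤ ENNReal.ofReal (S k) then
    (∑ k ∈ Finset.range (Nat.find h), ENNReal.ofReal (S k)) + T (Nat.find h)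
  else ∑' k, ENNReal.ofReal (S k)

/-- Expected running time of the multi-start algorithm for the random cutoff sequence `S`
(defined on the probability space `(Ω, P)`), when the running times of the successive runs are
i.i.d. with law `p` and independent of `S`. -/
def expectedRunTime {Ω : Type*} [MeasurableSpace Ω] (P : Measure Ω) (S : Ω → ℕ → ℝ)
    (p : Measure ℝ≥0∞) [IsProbabilityMeasure p] : ℝ≥0∞ :=
  ∫⁻ z, runTime (S z.1) z.2 ∂(P.prod (Measure.infinitePi fun _ : ℕ => p))

/-! ### The parallel restart strategy -/

/-- The cutoff sequence `S^q`, that is `S^q_k = (1 - q / 2) ^ (-k)`. -/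
def quantileCutoff (q : ℝ) (k : ℕ) : ℝ := ((1 - q / 2) ^ k)⁻¹

/-- The levels `q_i = 2 ^ (-i - 1)`. -/
def level (i : ℕ) : ℝ := (1 / 2) ^ (i + 1)

/-- `1 + i log² i`, with the logarithm in base `2` (it equals `1` at `i = 0`). -/
def slowdown (i : ℕ) : ℝ := 1 + i * Real.logb 2 i ^ 2

/-- The unnormalised probability of selecting the base sequence `S^{q_i}`, when each base
sequence `S^{q_j}` has already been selected `K j` times. -/
def selectionWeight (K : ℕ → ℕ) (i : ℕ) : ℝ :=
  (quantileCutoff (level i) (K i))⁻¹ / slowdown i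

lemma one_le_slowdown (i : ℕ) : 1 ≤ slowdown i := by
  unfold slowdown
  have : (0 : ℝ) ≤ i * Real.logb 2 i ^ 2 := by positivity
  linarith

lemma level_pos (i : ℕ) : 0 < level i := by unfold level; positivity

lemma level_le_one (i : ℕ) : level i ≤ 1 := by
  unfold level; exact pow_le_one₀ (by norm_num) (by norm_num)

lemma selectionWeight_pos (K : ℕ → ℕ) (i : ℕ) : 0 < selectionWeight K i := by
  have h1 := one_le_slowdown i
  have h2 := level_le_one i
  have h3 : 0 < 1 - level i / 2 := by linarith
  unfold selectionWeight quantileCutoff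
  positivity

lemma selectionWeight_le (K : ℕ → ℕ) (i : ℕ) : selectionWeight K i ≤ (slowdown i)⁻¹ := by
  have h1 := one_le_slowdown i
  have h2 := level_le_one i
  have h3 := level_pos i
  unfold selectionWeight quantileCutoff
  rw [inv_inv, ← one_div]
  gcongr
  exact pow_le_one₀ (by linarith) (by linarith)

lemma summable_inv_slowdown : Summable fun i => (slowdown i)⁻¹ := by
  rw [← summable_condensed_iff_of_nonneg]
  · rw [← summable_nat_add_iff 1]
    refine Summable.of_nonneg_of_le (fun k => ?_) (fun k => ?_)
      ((summable_nat_add_iff 1).2 (Real.summable_one_div_nat_pow.2 (le_refl 2)))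
    · have := one_le_slowdown (2 ^ (k + 1))
      positivity
    · have hlog : Real.logb 2 ((2 ^ (k + 1) : ℕ) : ℝ) = (k + 1 : ℕ) := by
        push_cast
        rw [Real.logb_pow, Real.logb_self_eq_one (by norm_num)]
        push_cast
        ring
      unfold slowdown
      rw [hlog, ← div_eq_mul_inv, div_le_div_iff₀ (by positivity) (by positivity)]
      push_cast
      linarith
  · intro n
    have := one_le_slowdown n
    positivity
  · intro m n hm hmn
    have h1 := one_le_slowdown m
    have hm' : (1 : ℝ) ≤ m := by exact_mod_cast hm
    have h2 : 0 ≤ Real.logb 2 (m : ℝ) := Real.logb_nonneg (by norm_num) hm'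
    apply inv_anti₀ (by linarith)
    unfold slowdown
    gcongr
    norm_num

lemma tsum_selectionWeight_ne_zero (K : ℕ → ℕ) :
    ∑' i, ENNReal.ofReal (selectionWeight K i) ≠ 0 := by
  intro h
  have := ENNReal.tsum_eq_zero.1 h 0
  rw [ENNReal.ofReal_eq_zero] at this
  exact absurd (selectionWeight_pos K 0) (not_lt.2 this)

lemma tsum_selectionWeight_ne_top (K : ℕ → ℕ) :
    ∑' i, ENNReal.ofReal (selectionWeight K i) ≠ ∞ := by
  have h : Summable (selectionWeight K) :=
    Summable.of_nonneg_of_le (fun i => (selectionWeight_pos K i).le) (selectionWeight_le K)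
      summable_inv_slowdown
  rw [← ENNReal.ofReal_tsum_of_nonneg (fun i => (selectionWeight_pos K i).le) h]
  exact ENNReal.ofReal_ne_top

/-- The law of the next selected index given the selection counts `K`: index `i` has probability
proportional to `(1 - 2 ^ (-i - 2)) ^ (K i) / (1 + i log² i)`. -/
def selectionPMF (K : ℕ → ℕ) : PMF ℕ :=
  PMF.normalize (fun i => ENNReal.ofReal (selectionWeight K i))
    (tsum_selectionWeight_ne_zero K) (tsum_selectionWeight_ne_top K)

/-- Number of times that each index was selected in the rounds `0, …, n`. -/
def selectionCount {n : ℕ} (x : Finset.Iic n → ℕ) (i : ℕ) : ℕ :=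
  (Finset.univ.filter fun j => x j = i).card

/-- Conditional law of the index selected in round `n + 1` given those of rounds `0, …, n`. -/
def selectionKernel (n : ℕ) : Kernel (Finset.Iic n → ℕ) ℕ :=
  Kernel.ofFunOfCountable fun x => (selectionPMF (selectionCount x)).toMeasure

instance (n : ℕ) : IsMarkovKernel (selectionKernel n) :=
  ⟨fun x => inferInstanceAs
    (IsProbabilityMeasure (selectionPMF (selectionCount x)).toMeasure)⟩

/-- The law of the sequence of the indices selected in the rounds `0, 1, 2, …`. -/
def indexLaw : Measure (ℕ → ℕ) :=
  Kernel.trajMeasure (X := fun _ => ℕ) (selectionPMF fun _ => 0).toMeasure selectionKernel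

/-- The cutoff sequence of the parallel restart strategy as a function of the selected indices `I`:
in round `n` the next unused term of the base sequence `S^{q_i}` with `i = I n` is used. -/
def prsCutoff (I : ℕ → ℕ) (n : ℕ) : ℝ :=
  quantileCutoff (level (I n)) ((Finset.range n).filter fun j => I j = I n).card

/-- Expected running time of the parallel restart strategy for the running-time law `p`. -/
def prsTime (p : Measure ℝ≥0∞) [IsProbabilityMeasure p] : ℝ≥0∞ :=
  expectedRunTime indexLaw prsCutoff p

/-! ### Generalised means -/

/-- The extension to `[1, ∞]` of an increasing function `φ : [1, ∞) → [0, ∞)`, with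
`φ(∞) = sup φ = lim_{t → ∞} φ(t)`. -/
def extend (φ : ℝ → ℝ) (t : ℝ≥0∞) : ℝ≥0∞ :=
  if t = ∞ then ⨆ s ∈ Set.Ici (1 : ℝ), ENNReal.ofReal (φ s) else ENNReal.ofReal (φ t.toReal)

/-- The generalised mean `φ⁻¹(𝔼[φ(T)])` of `T ∼ p`, where `φ⁻¹` is the inverse of the extension
of `φ` to `[1, ∞]`. -/
def genMean (φ : ℝ → ℝ) (p : Measure ℝ≥0∞) : ℝ≥0∞ :=
  Function.invFunOn (extend φ) (Set.Icc 1 ∞) (∫⁻ t, extend φ t ∂p)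

end Restart

end

noncomputable section

namespace Restart

/-! ### The base sequences -/

/-! The selection probability of a level is inversely proportional to its next cutoff, up to the
slowdown. Hence, given the past, the expected cutoff spent on level `j` in the next round is
proportional to `1 / slowdown j`, whatever the counters are. Survival up to round `n` depends only
on earlier rounds, so summing over rounds bounds the total time by `slowdownMass * slowdown i` times
the cutoffs paid on any one level `i` (`lintegral_prsCutoff_mul`). Runs on other levels can only end
the search sooner, so that part costs no more than `S^{q_i}` run alone, which is `O(u / q_i)` as
soon as `P(T ≤ u) ≥ q_i`: along `S^q` the survival probability decays faster than the cutoffs grow.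
This gives `prsTime_le_of_quantile`.

It remains to find a good level. The thresholds `u_i = A m 2^{-i} / slowdown i` make the resulting
bound a multiple of `A m` for every `i`. If `P(T ≤ u_i) < q_i` for all `i`, then `T > u_0 ≥ 2m` with
probability at least `1/2`, which raises `𝔼[φ(T)]` above `φ(m)` by at least half of `D = φ(2m) -
φ(m)`. The loss from small `T` is controlled by `φ(m) - φ(s) ≤ K D (m/s)^γ`; for `γ < 1` it sums to
at most a constant times `D A^{-γ}`. A large `A` then forces `𝔼[φ(T)] > φ(m)`
(`exists_level_le_measure`).

The condition on `φ''` makes `t^β φ'(t)` nondecreasing up to a constant for some `β < 2`, and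
integration yields the loss estimate with `γ = β - 1`. For the logarithm and the powers the estimate
is verified directly, which also covers the powers `a > 1`, where concavity fails. -/

lemma quantileCutoff_pos {q : ℝ} (hq : q ≤ 1) (k : ℕ) : 0 < quantileCutoff q k := by
  have : 0 < 1 - q / 2 := by linarith
  unfold quantileCutoff
  positivity

lemma quantileCutoff_mono {q : ℝ} (hq0 : 0 ≤ q) (hq : q ≤ 1) : Monotone (quantileCutoff q) := by
  intro k l hkl
  have : 0 < 1 - q / 2 := by linarith
  unfold quantileCutoff
  exact inv_anti₀ (by positivity) (pow_le_pow_of_le_one this.le (by linarith) hkl)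

lemma quantileCutoff_add (q : ℝ) (k l : ℕ) :
    quantileCutoff q (k + l) = quantileCutoff q k * quantileCutoff q l := by
  unfold quantileCutoff
  rw [pow_add, mul_inv]

/-- The sum of the cutoffs of `S^q` before rank `n` is at most a multiple of the cutoff of
rank `n`. -/
lemma sum_quantileCutoff_le {q : ℝ} (hq0 : 0 < q) (hq : q ≤ 1) (n : ℕ) :
    ∑ k ∈ Finset.range n, quantileCutoff q k ≤ quantileCutoff q n * (2 / q) := by
  induction n with
  | zero => simp [quantileCutoff]; positivity
  | succ n ih =>
    rw [Finset.sum_range_succ]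
    have h0 := quantileCutoff_pos hq (n + 1)
    have h1 : quantileCutoff q n = quantileCutoff q (n + 1) * (1 - q / 2) := by
      have : (1 - q / 2) ≠ 0 := by linarith
      rw [quantileCutoff_add]
      simp only [quantileCutoff, pow_one]
      rw [mul_assoc, inv_mul_cancel₀ this, mul_one]
    have h2 : quantileCutoff q n * (2 / q) + quantileCutoff q n
        = quantileCutoff q (n + 1) * (2 / q) * (1 - (q / 2) ^ 2) := by
      rw [h1]; field_simp; ring
    have h3 : 0 ≤ quantileCutoff q (n + 1) * (2 / q) := by positivity
    nlinarith [mul_nonneg h3 (sq_nonneg (q / 2))]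

/-- The first cutoff of `S^q` that exceeds `u ≥ 1` is at most `2 u`. -/
lemma exists_quantileCutoff {q u : ℝ} (hq0 : 0 < q) (hq : q ≤ 1) (hu : 1 ≤ u) :
    ∃ n, u ≤ quantileCutoff q n ∧ quantileCutoff q n ≤ 2 * u := by
  classical
  have h : ∃ n, u ≤ quantileCutoff q n := by
    obtain ⟨n, hn⟩ := pow_unbounded_of_one_lt u (y := (1 - q / 2)⁻¹)
      ((one_lt_inv₀ (by linarith)).2 (by linarith))
    exact ⟨n, by unfold quantileCutoff; rw [← inv_pow]; exact hn.le⟩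
  refine ⟨Nat.find h, Nat.find_spec h, ?_⟩
  rcases hn : Nat.find h with _ | n
  · simp [quantileCutoff]; linarith
  · have h1 : quantileCutoff q n < u := not_le.1 (Nat.find_min h (by omega))
    -- Consecutive cutoffs have ratio `(1 - q/2)⁻¹`, at most `2` because `q ≤ 1`, so the first one
    -- past `u` overshoots by at most this factor.
    have h2 : quantileCutoff q 1 ≤ 2 := by
      simp only [quantileCutoff, pow_one]
      rw [inv_le_comm₀ (by linarith) (by norm_num)]
      linarith
    rw [quantileCutoff_add]
    have := quantileCutoff_pos hq n
    nlinarith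

/-- Since `1 - q ≤ (1 - q/2)²`, one factor `1 - q/2` of the survival probability pays for the growth
of the cutoff and the other is left as geometric decay. -/
lemma quantileCutoff_mul_pow_le {q u : ℝ} (hq : q ≤ 1) (hu : 0 ≤ u) {n : ℕ}
    (hn : quantileCutoff q n ≤ u) (k : ℕ) :
    quantileCutoff q (n + k) * (1 - q) ^ k ≤ u * (1 - q / 2) ^ k := by
  have hr : 0 < 1 - q / 2 := by linarith
  have h3 : quantileCutoff q k * (1 - q) ^ k ≤ (1 - q / 2) ^ k := by
    unfold quantileCutoff
    rw [inv_mul_le_iff₀ (by positivity), ← mul_pow]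
    exact pow_le_pow_left₀ (by linarith) (by nlinarith [sq_nonneg q]) k
  rw [quantileCutoff_add, mul_assoc]
  exact mul_le_mul hn h3 (mul_nonneg (quantileCutoff_pos hq _).le
    (pow_nonneg (by linarith) _)) hu

lemma hasSum_geometric_half_level {q : ℝ} (hq0 : 0 < q) (hq : q ≤ 1) (u : ℝ) :
    HasSum (fun k : ℕ => u * (1 - q / 2) ^ k) (u * (2 / q)) := by
  have := (hasSum_geometric_of_lt_one (r := 1 - q / 2) (by linarith) (by linarith)).mul_left u
  rwa [sub_sub_cancel, inv_div] at this

/-- Running the base sequence `S^q` alone takes expected time at most `8 u / q` when each run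
with cutoff at least `u` fails with probability `f` at most `1 - q`. -/
lemma tsum_quantileCutoff_mul_prod_le {q u : ℝ} (hq0 : 0 < q) (hq : q ≤ 1) (hu : 1 ≤ u)
    (f : ℝ → ℝ≥0∞) (hf1 : ∀ s, f s ≤ 1) (hf : ∀ s, u ≤ s → f s ≤ ENNReal.ofReal (1 - q)) :
    ∑' k, ENNReal.ofReal (quantileCutoff q k) * ∏ l ∈ Finset.range k, f (quantileCutoff q l)
      ≤ ENNReal.ofReal (8 * u / q) := by
  -- The series is split at this `n`. Before it, survival is bounded by `1` and the cutoffs sum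
  -- geometrically; from it on, every run fails with probability at most `1 - q`. Each part
  -- contributes `4u/q`.
  obtain ⟨n, hn, hn2⟩ := exists_quantileCutoff hq0 hq hu
  have hle (k : ℕ) : ∏ l ∈ Finset.range k, f (quantileCutoff q l) ≤ 1 :=
    Finset.prod_le_one' fun l _ => hf1 _
  have hprod (k : ℕ) : ∏ l ∈ Finset.range (k + n), f (quantileCutoff q l)
      ≤ ENNReal.ofReal (1 - q) ^ k := by
    rw [add_comm, Finset.prod_range_add]
    refine (mul_le_of_le_one_left' (hle n)).trans ?_
    refine (Finset.prod_le_pow_card _ _ (ENNReal.ofReal (1 - q)) fun l _ => ?_).trans_eq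
      (by rw [Finset.card_range])
    exact hf _ (hn.trans (quantileCutoff_mono hq0.le hq (by omega)))
  have h1 : ∑ k ∈ Finset.range n, ENNReal.ofReal (quantileCutoff q k) *
      ∏ l ∈ Finset.range k, f (quantileCutoff q l) ≤ ENNReal.ofReal (2 * u * (2 / q)) := by
    refine (Finset.sum_le_sum fun k _ => mul_le_of_le_one_right' (hle k)).trans ?_
    rw [← ENNReal.ofReal_sum_of_nonneg fun k _ => (quantileCutoff_pos hq k).le]
    apply ENNReal.ofReal_le_ofReal
    refine (sum_quantileCutoff_le hq0 hq n).trans ?_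
    gcongr
  have h2 : ∑' k, ENNReal.ofReal (quantileCutoff q (k + n)) *
      ∏ l ∈ Finset.range (k + n), f (quantileCutoff q l) ≤ ENNReal.ofReal (2 * u * (2 / q)) := by
    have hgeom := hasSum_geometric_half_level hq0 hq (2 * u)
    have hr : 0 ≤ 1 - q / 2 := by linarith
    rw [← hgeom.tsum_eq, ENNReal.ofReal_tsum_of_nonneg
      (fun k => mul_nonneg (by linarith) (pow_nonneg hr k)) hgeom.summable]
    refine ENNReal.tsum_le_tsum fun k => ?_
    refine (mul_le_mul_right (hprod k) _).trans ?_
    rw [← ENNReal.ofReal_pow (by linarith),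
      ← ENNReal.ofReal_mul (quantileCutoff_pos hq _).le, add_comm k n]
    exact ENNReal.ofReal_le_ofReal (quantileCutoff_mul_pow_le hq (by linarith) hn2 k)
  rw [← ENNReal.summable.sum_add_tsum_nat_add' (k := n)]
  refine (add_le_add h1 h2).trans ?_
  rw [← ENNReal.ofReal_add (by positivity) (by positivity)]
  apply ENNReal.ofReal_le_ofReal
  apply le_of_eq
  ring

/-! ### The law of the selected indices -/

/-- The normalising constant `∑ 1 / (1 + j log² j)`. -/
def slowdownMass : ℝ≥0∞ := ∑' j, ENNReal.ofReal (slowdown j)⁻¹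

lemma slowdownMass_ne_top : slowdownMass ≠ ∞ := by
  have h (j : ℕ) : 0 ≤ (slowdown j)⁻¹ := by have := one_le_slowdown j; positivity
  rw [slowdownMass, ← ENNReal.ofReal_tsum_of_nonneg h summable_inv_slowdown]
  exact ENNReal.ofReal_ne_top

/-- The cutoff cancels against the weight, so the counters survive only in the normalising factor,
which is common to all levels `j`. -/
lemma ofReal_cutoff_mul_selectionPMF (K : ℕ → ℕ) (j : ℕ) :
    ENNReal.ofReal (quantileCutoff (level j) (K j)) * selectionPMF K j =
      ENNReal.ofReal (slowdown j)⁻¹ * (∑' i, ENNReal.ofReal (selectionWeight K i))⁻¹ := by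
  have h := quantileCutoff_pos (level_le_one j) (K j)
  rw [selectionPMF, PMF.normalize_apply, ← mul_assoc, ← ENNReal.ofReal_mul h.le]
  congr 2
  rw [selectionWeight, div_eq_mul_inv, mul_inv_cancel_left₀ h.ne']

/-- The mean cutoff of a round is proportional to the part that is spent on level `i`. -/
lemma lintegral_cutoff_selectionPMF (K : ℕ → ℕ) (i : ℕ) :
    ∫⁻ j, ENNReal.ofReal (quantileCutoff (level j) (K j)) ∂(selectionPMF K).toMeasure =
      slowdownMass * ENNReal.ofReal (slowdown i) *
        ∫⁻ j, (if j = i then ENNReal.ofReal (quantileCutoff (level j) (K j)) else 0)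
          ∂(selectionPMF K).toMeasure := by
  have hs : 0 < slowdown i := by have := one_le_slowdown i; linarith
  rw [lintegral_countable', lintegral_countable']
  simp only [PMF.toMeasure_apply_singleton _ _ (measurableSet_singleton _),
    ofReal_cutoff_mul_selectionPMF, ENNReal.tsum_mul_right, ite_mul, zero_mul]
  rw [tsum_ite_eq, ← slowdownMass, mul_assoc, ← mul_assoc (ENNReal.ofReal (slowdown i)),
    ← ENNReal.ofReal_mul hs.le, mul_inv_cancel₀ hs.ne', ENNReal.ofReal_one, one_mul]

/-- A sequence with the given initial terms. -/
def padZero {n : ℕ} (x : Finset.Iic n → ℕ) (m : ℕ) : ℕ :=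
  if h : m ∈ Finset.Iic n then x ⟨m, h⟩ else 0

lemma padZero_frestrictLe {n m : ℕ} (I : ℕ → ℕ) (h : m ≤ n) :
    padZero (Preorder.frestrictLe (π := fun _ => ℕ) n I) m = I m := by
  simp [padZero, h]

lemma dependsOn_eq_padZero {α : Type*} {n : ℕ} {g : (ℕ → ℕ) → α} (hg : DependsOn g (Set.Iic n))
    (I : ℕ → ℕ) : g I = g (padZero (Preorder.frestrictLe (π := fun _ => ℕ) n I)) :=
  hg fun _ hm => (padZero_frestrictLe I hm).symm

/-- Histories of finite length form a countable discrete space, so a function that factors through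
them is automatically measurable. -/
lemma measurable_of_dependsOn_Iic {α : Type*} [MeasurableSpace α] {n : ℕ} {g : (ℕ → ℕ) → α}
    (hg : DependsOn g (Set.Iic n)) : Measurable g := by
  have : g = (fun x : Finset.Iic n → ℕ => g (padZero x)) ∘
      Preorder.frestrictLe (π := fun _ => ℕ) n := by
    ext I
    exact dependsOn_eq_padZero hg I
  rw [this]
  exact Measurable.of_discrete.comp (Preorder.measurable_frestrictLe n)

instance : IsProbabilityMeasure indexLaw := by unfold indexLaw; infer_instance

lemma lintegral_indexLaw_zero (F : ℕ → ℝ≥0∞) :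
    ∫⁻ I, F (I 0) ∂indexLaw = ∫⁻ j, F j ∂(selectionPMF fun _ => 0).toMeasure := by
  have h : indexLaw.map (fun I => I 0) = (selectionPMF fun _ => 0).toMeasure := by
    have h0 : (fun I : ℕ → ℕ => I 0) =
        (fun x : Finset.Iic 0 → ℕ => x ⟨0, Finset.mem_Iic.2 le_rfl⟩) ∘
          Preorder.frestrictLe (π := fun _ => ℕ) 0 := rfl
    rw [h0]
    refine (Measure.map_map (μ := indexLaw) (g := fun x : Finset.Iic 0 → ℕ =>
      x ⟨0, Finset.mem_Iic.2 le_rfl⟩) (measurable_pi_apply _)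
      (Preorder.measurable_frestrictLe (X := fun _ => ℕ) 0)).symm.trans ?_
    rw [indexLaw, Kernel.trajMeasure, Measure.map_comp _ _ (by fun_prop), Kernel.traj_map_frestrictLe,
      Kernel.partialTraj_self, Measure.id_comp, Measure.map_map (by fun_prop) (by fun_prop)]
    exact Measure.map_id
  rw [← h, lintegral_map .of_discrete (measurable_pi_apply 0)]

/-- The joint law of a history and the next index is the composition-product of the history's law
with `selectionKernel`; this is the only form in which the conditional law is used. -/
lemma lintegral_indexLaw_succ (n : ℕ) (F : (Finset.Iic n → ℕ) × ℕ → ℝ≥0∞) :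
    ∫⁻ I, F (Preorder.frestrictLe (π := fun _ => ℕ) n I, I (n + 1)) ∂indexLaw =
      ∫⁻ I, ∫⁻ j, F (Preorder.frestrictLe (π := fun _ => ℕ) n I, j)
        ∂(selectionPMF (selectionCount (Preorder.frestrictLe (π := fun _ => ℕ) n I))).toMeasure
        ∂indexLaw := by
  have h := Kernel.map_frestrictLe_trajMeasure_compProd_eq_map_trajMeasure (X := fun _ => ℕ)
    (μ₀ := (selectionPMF fun _ => 0).toMeasure) (κ := selectionKernel) (a := n)
  have hF : Measurable F := .of_discrete
  have hr : Measurable (Preorder.frestrictLe (π := fun _ : ℕ => ℕ) n) :=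
    Preorder.measurable_frestrictLe n
  rw [← lintegral_map (f := F) hF (hr.prodMk (measurable_pi_apply (n + 1)))]
  unfold indexLaw
  erw [← h]
  rw [Measure.lintegral_compProd hF, lintegral_map .of_discrete hr]
  rfl

/-- Number of rounds before round `n` in which `i` was selected. -/
def visits (I : ℕ → ℕ) (n i : ℕ) : ℕ := ((Finset.range n).filter fun j => I j = i).card

lemma visits_succ (I : ℕ → ℕ) (n i : ℕ) :
    visits I (n + 1) i = visits I n i + if I n = i then 1 else 0 := by
  unfold visits
  rw [Finset.range_add_one, Finset.filter_insert]
  split_ifs <;> simp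

lemma visits_congr {I J : ℕ → ℕ} {n : ℕ} (h : ∀ m < n, I m = J m) (i : ℕ) :
    visits I n i = visits J n i := by
  unfold visits
  congr 1
  exact Finset.filter_congr fun m hm => by rw [h m (Finset.mem_range.1 hm)]

lemma prsCutoff_eq (I : ℕ → ℕ) (n : ℕ) :
    prsCutoff I n = quantileCutoff (level (I n)) (visits I n (I n)) := rfl

lemma selectionCount_frestrictLe (I : ℕ → ℕ) (n i : ℕ) :
    selectionCount (Preorder.frestrictLe (π := fun _ => ℕ) n I) i = visits I (n + 1) i := by
  unfold selectionCount visits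
  refine Finset.card_bij (fun m _ => (m : ℕ)) ?_ (fun a _ b _ h => Subtype.ext h) ?_
  · intro a ha
    have h1 := Finset.mem_Iic.1 a.2
    exact Finset.mem_filter.2 ⟨Finset.mem_range.2 (by omega), (Finset.mem_filter.1 ha).2⟩
  · intro m hm
    simp only [Finset.mem_filter, Finset.mem_range] at hm
    exact ⟨⟨m, Finset.mem_Iic.2 (by omega)⟩, 
      Finset.mem_filter.2 ⟨Finset.mem_univ _, hm.2⟩, rfl⟩

lemma dependsOn_prsCutoff (n : ℕ) : DependsOn (fun I => prsCutoff I n) (Set.Iic n) := by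
  intro I J h
  have hn : I n = J n := h n (Set.mem_Iic.2 le_rfl)
  simp only [prsCutoff_eq, hn]
  rw [visits_congr fun m hm => h m (Set.mem_Iic.2 (by omega))]

lemma measurable_prsCutoff (n : ℕ) : Measurable fun I => prsCutoff I n :=
  measurable_of_dependsOn_Iic (dependsOn_prsCutoff n)

/-- On an event that is determined by the previous rounds, the mean cutoff of round `n` is
proportional to the part that is spent on level `i`. -/
lemma lintegral_prsCutoff_mul (n i : ℕ) {g : (ℕ → ℕ) → ℝ≥0∞} (hg : DependsOn g (Set.Iio n)) :
    ∫⁻ I, ENNReal.ofReal (prsCutoff I n) * g I ∂indexLaw =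
      slowdownMass * ENNReal.ofReal (slowdown i) *
        ∫⁻ I, (if I n = i then ENNReal.ofReal (prsCutoff I n) else 0) * g I ∂indexLaw := by
  have hZ : slowdownMass * ENNReal.ofReal (slowdown i) ≠ ∞ :=
    ENNReal.mul_ne_top slowdownMass_ne_top ENNReal.ofReal_ne_top
  -- Round `0` is drawn from the initial law, where `g` is constant; later rounds are drawn from the
  -- kernel, given a history on which `g` depends.
  rcases n with _ | n
  · have hc : ∀ I, g I = g 0 := fun I => hg (by simp)
    have hp : ∀ I, prsCutoff I 0 = quantileCutoff (level (I 0)) 0 := fun I => by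
      simp [prsCutoff_eq, visits]
    simp only [hc, hp]
    rw [lintegral_indexLaw_zero fun j => ENNReal.ofReal (quantileCutoff (level j) 0) * g 0,
      lintegral_indexLaw_zero fun j =>
        (if j = i then ENNReal.ofReal (quantileCutoff (level j) 0) else 0) * g 0,
      lintegral_mul_const _ .of_discrete, lintegral_mul_const _ .of_discrete,
      lintegral_cutoff_selectionPMF _ i, mul_assoc]
  · have hg' : DependsOn g (Set.Iic n) := by
      convert hg using 1
      ext m
      simp
    have hp : ∀ I, prsCutoff I (n + 1) = quantileCutoff (level (I (n + 1)))
        (selectionCount (Preorder.frestrictLe (π := fun _ => ℕ) n I) (I (n + 1))) := fun I => by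
      rw [selectionCount_frestrictLe, prsCutoff_eq]
    obtain ⟨g', hg'⟩ : ∃ g' : (Finset.Iic n → ℕ) → ℝ≥0∞,
        ∀ I, g I = g' (Preorder.frestrictLe (π := fun _ => ℕ) n I) :=
      ⟨fun x => g (padZero x), dependsOn_eq_padZero hg'⟩
    simp only [hp, hg']
    rw [lintegral_indexLaw_succ n fun z =>
        ENNReal.ofReal (quantileCutoff (level z.2) (selectionCount z.1 z.2)) * g' z.1,
      lintegral_indexLaw_succ n fun z =>
        (if z.2 = i then ENNReal.ofReal (quantileCutoff (level z.2) (selectionCount z.1 z.2))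
          else 0) * g' z.1, ← lintegral_const_mul' _ _ hZ]
    congr 1 with I
    dsimp only
    rw [lintegral_mul_const _ .of_discrete, lintegral_mul_const _ .of_discrete,
      lintegral_cutoff_selectionPMF _ i, mul_assoc]

/-! ### Bounding the expected running time -/

/-- Charging the successful run its whole cutoff makes each round cost its cutoff exactly when all
earlier runs failed. -/
lemma runTime_le (S : ℕ → ℝ) (T : ℕ → ℝ≥0∞) :
    runTime S T ≤ ∑' n, ENNReal.ofReal (S n) *
      Set.indicator {T : ℕ → ℝ≥0∞ | ∀ m < n, ENNReal.ofReal (S m) < T m} 1 T := by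
  classical
  have hterm {n : ℕ} (hn : ∀ m < n, ENNReal.ofReal (S m) < T m) :
      ENNReal.ofReal (S n) *
        Set.indicator {T : ℕ → ℝ≥0∞ | ∀ m < n, ENNReal.ofReal (S m) < T m} 1 T =
      ENNReal.ofReal (S n) := by
    rw [Set.indicator_of_mem (by exact hn), Pi.one_apply, mul_one]
  unfold runTime
  split_ifs with h
  · refine le_trans ?_ (ENNReal.sum_le_tsum (Finset.range (Nat.find h + 1)))
    have hlt : ∀ m < Nat.find h, ENNReal.ofReal (S m) < T m := fun m hm =>
      not_le.1 (Nat.find_min h hm)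
    rw [Finset.sum_congr rfl fun n hn => hterm fun m hm => hlt m
      (by have := Finset.mem_range.1 hn; omega), Finset.sum_range_succ]
    gcongr
    convert Nat.find_spec h
  · push Not at h
    exact (tsum_congr fun n => (hterm fun m _ => h m).symm).le

/-- Expected running time with deterministic cutoffs. -/
lemma lintegral_runTime_le (S : ℕ → ℝ) (p : Measure ℝ≥0∞) [IsProbabilityMeasure p] :
    ∫⁻ T, runTime S T ∂(Measure.infinitePi fun _ : ℕ => p) ≤
      ∑' n, ENNReal.ofReal (S n) *
        ∏ m ∈ Finset.range n, p (Set.Ioi (ENNReal.ofReal (S m))) := by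
  have hset (n : ℕ) : {T : ℕ → ℝ≥0∞ | ∀ m < n, ENNReal.ofReal (S m) < T m} =
      Set.pi (Finset.range n) fun m => Set.Ioi (ENNReal.ofReal (S m)) := by
    ext T; simp
  have hmeas (n : ℕ) :
      MeasurableSet {T : ℕ → ℝ≥0∞ | ∀ m < n, ENNReal.ofReal (S m) < T m} := by
    rw [hset]
    exact .pi (Finset.countable_toSet _) fun _ _ => measurableSet_Ioi
  refine (lintegral_mono fun T => runTime_le S T).trans_eq ?_
  rw [lintegral_tsum fun n => ((measurable_one.indicator (hmeas n)).const_mul _).aemeasurable]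
  congr 1 with n
  rw [lintegral_const_mul _ (measurable_one.indicator (hmeas n)), lintegral_indicator_one (hmeas n),
    hset, Measure.infinitePi_pi _ fun _ _ => measurableSet_Ioi]

/-- Rounds on level `i` sum up to the terms of the base sequence. -/
lemma sum_ite_visits (I : ℕ → ℕ) (i n : ℕ) (g : ℕ → ℝ≥0∞) :
    ∑ m ∈ Finset.range n, (if I m = i then g (visits I m i) else 0) =
      ∑ k ∈ Finset.range (visits I n i), g k := by
  induction n with
  | zero => simp [visits]
  | succ n ih =>
    rw [Finset.sum_range_succ, ih, visits_succ]
    split_ifs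
    · rw [Finset.sum_range_succ]
    · simp

/-- The runs on level `i` alone bound the probability that no run succeeded. -/
lemma prod_prsCutoff_le (I : ℕ → ℕ) (i n : ℕ) {f : ℝ → ℝ≥0∞} (hf : ∀ s, f s ≤ 1) :
    ∏ m ∈ Finset.range n, f (prsCutoff I m) ≤
      ∏ k ∈ Finset.range (visits I n i), f (quantileCutoff (level i) k) := by
  induction n with
  | zero => simp [visits]
  | succ n ih =>
    rw [Finset.prod_range_succ, visits_succ]
    split_ifs with h
    · rw [Finset.prod_range_succ, prsCutoff_eq, h]
      gcongr
    · exact (mul_le_of_le_one_right' (hf _)).trans ih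

/-- The rounds on level `i` run through an initial segment of its base sequence, possibly finite,
while rounds on other levels add no cost here and only lower the survival product. -/
lemma tsum_level_le (I : ℕ → ℕ) (i : ℕ) {f : ℝ → ℝ≥0∞} (hf : ∀ s, f s ≤ 1) :
    ∑' n, (if I n = i then ENNReal.ofReal (prsCutoff I n) else 0) *
        ∏ m ∈ Finset.range n, f (prsCutoff I m) ≤
      ∑' k, ENNReal.ofReal (quantileCutoff (level i) k) *
        ∏ l ∈ Finset.range k, f (quantileCutoff (level i) l) := by
  set g : ℕ → ℝ≥0∞ := fun k => ENNReal.ofReal (quantileCutoff (level i) k) *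
    ∏ l ∈ Finset.range k, f (quantileCutoff (level i) l)
  rw [ENNReal.tsum_eq_iSup_nat]
  refine iSup_le fun n => ?_
  refine le_trans ?_ (ENNReal.sum_le_tsum (Finset.range (visits I n i)))
  rw [← sum_ite_visits]
  refine Finset.sum_le_sum fun m _ => ?_
  split_ifs with h
  · rw [prsCutoff_eq, h]
    exact mul_le_mul_right (prod_prsCutoff_le I i m hf) _
  · simp

/-- If a run is shorter than `u` with probability at least `q_i`, then the parallel restart
strategy takes expected time at most `O((1 + i log² i) u / q_i)`. -/
theorem prsTime_le_of_quantile (p : Measure ℝ≥0∞) [IsProbabilityMeasure p] (i : ℕ) {u : ℝ}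
    (hu : 1 ≤ u) (hp : ENNReal.ofReal (level i) ≤ p (Set.Iic (ENNReal.ofReal u))) :
    prsTime p ≤ slowdownMass * ENNReal.ofReal (slowdown i * (8 * u / level i)) := by
  have hs : 0 ≤ slowdown i := by have := one_le_slowdown i; linarith
  set f : ℝ → ℝ≥0∞ := fun s => p (Set.Ioi (ENNReal.ofReal s)) with hf
  have hf1 (s : ℝ) : f s ≤ 1 := prob_le_one
  have hfu (s : ℝ) (h : u ≤ s) : f s ≤ ENNReal.ofReal (1 - level i) := by
    calc f s ≤ p (Set.Iic (ENNReal.ofReal u))ᶜ := by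
          rw [Set.compl_Iic]
          exact measure_mono (Set.Ioi_subset_Ioi (ENNReal.ofReal_le_ofReal h))
      _ = 1 - p (Set.Iic (ENNReal.ofReal u)) := prob_compl_eq_one_sub measurableSet_Iic
      _ ≤ 1 - ENNReal.ofReal (level i) := tsub_le_tsub_left hp _
      _ = _ := by rw [ENNReal.ofReal_sub _ (level_pos i).le, ENNReal.ofReal_one]
  have hfmeas : Measurable f := by
    have : Antitone f := fun s t h =>
      measure_mono (Set.Ioi_subset_Ioi (ENNReal.ofReal_le_ofReal h))
    exact this.measurable
  have hG (n : ℕ) : Measurable fun I => ∏ m ∈ Finset.range n, f (prsCutoff I m) :=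
    Finset.measurable_fun_prod _ fun m _ => hfmeas.comp (measurable_prsCutoff m)
  have hGdep (n : ℕ) :
      DependsOn (fun I => ∏ m ∈ Finset.range n, f (prsCutoff I m)) (Set.Iio n) := by
    intro I J h
    refine Finset.prod_congr rfl fun m hm => ?_
    have hm := Finset.mem_range.1 hm
    have : prsCutoff I m = prsCutoff J m := dependsOn_prsCutoff m fun k hk =>
      h k (lt_of_le_of_lt hk hm)
    rw [this]
  have hc (n : ℕ) : Measurable fun I => ENNReal.ofReal (prsCutoff I n) :=
    (measurable_prsCutoff n).ennreal_ofReal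
  have hci (n : ℕ) :
      Measurable fun I : ℕ → ℕ => if I n = i then ENNReal.ofReal (prsCutoff I n) else 0 :=
    Measurable.ite (measurable_pi_apply (X := fun _ => ℕ) n (measurableSet_singleton i)) (hc n) measurable_const
  -- Only this inequality of Tonelli's theorem is needed, and it holds without joint measurability
  -- of the running time.
  calc prsTime p ≤ ∫⁻ I, ∫⁻ T, runTime (prsCutoff I) T ∂(Measure.infinitePi fun _ : ℕ => p)
          ∂indexLaw := lintegral_prod_le _
    _ ≤ ∫⁻ I, ∑' n, ENNReal.ofReal (prsCutoff I n) *
          ∏ m ∈ Finset.range n, f (prsCutoff I m) ∂indexLaw :=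
        lintegral_mono fun I => lintegral_runTime_le _ p
    _ = ∑' n, ∫⁻ I, ENNReal.ofReal (prsCutoff I n) *
          ∏ m ∈ Finset.range n, f (prsCutoff I m) ∂indexLaw :=
        lintegral_tsum fun n => ((hc n).mul (hG n)).aemeasurable
    _ = slowdownMass * ENNReal.ofReal (slowdown i) *
          ∫⁻ I, ∑' n, (if I n = i then ENNReal.ofReal (prsCutoff I n) else 0) *
            ∏ m ∈ Finset.range n, f (prsCutoff I m) ∂indexLaw := by
        have hm (n : ℕ) : Measurable fun I : ℕ → ℕ =>
            (if I n = i then ENNReal.ofReal (prsCutoff I n) else 0) *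
              ∏ m ∈ Finset.range n, f (prsCutoff I m) := (hci n).mul (hG n)
        rw [lintegral_tsum fun n => (hm n).aemeasurable, ← ENNReal.tsum_mul_left]
        exact tsum_congr fun n => lintegral_prsCutoff_mul n i (hGdep n)
    _ ≤ slowdownMass * ENNReal.ofReal (slowdown i) *
          ∫⁻ _, ENNReal.ofReal (8 * u / level i) ∂indexLaw := by
        gcongr with I
        exact (tsum_level_le I i hf1).trans
          (tsum_quantileCutoff_mul_prod_le (level_pos i) (level_le_one i) hu f hf1 hfu)
    _ = _ := by
        rw [lintegral_const, measure_univ, mul_one, mul_assoc, ← ENNReal.ofReal_mul hs]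

/-! ### From quantiles to generalised means -/

lemma slowdown_le (i : ℕ) : slowdown i ≤ 1 + (i : ℝ) ^ 3 := by
  unfold slowdown
  rcases Nat.eq_zero_or_pos i with rfl | hi
  · simp
  have h1 : (1 : ℝ) ≤ i := by exact_mod_cast hi
  have h2 : Real.logb 2 i ≤ i := by
    rw [Real.logb_le_iff_le_rpow (by norm_num) (by linarith), Real.rpow_natCast]
    exact_mod_cast Nat.lt_two_pow_self.le
  have h3 : 0 ≤ Real.logb 2 i := Real.logb_nonneg (by norm_num) h1
  have h4 : Real.logb 2 i ^ 2 ≤ (i : ℝ) ^ 2 := by gcongr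
  nlinarith

/-- The loss of levels `i + 1, i + 2, …` relative to a mean with exponent `γ < 1`. -/
def levelLoss (γ : ℝ) (i : ℕ) : ℝ := level i * (2 ^ (i + 1) * slowdown (i + 1)) ^ γ

lemma levelLoss_nonneg (γ : ℝ) (i : ℕ) : 0 ≤ levelLoss γ i := by
  have := one_le_slowdown (i + 1)
  have := level_pos i
  unfold levelLoss
  positivity

/-- The geometric ratio is `2^(γ-1) < 1`, and the slowdown enters only as a polynomial factor. -/
lemma summable_levelLoss {γ : ℝ} (h0 : 0 < γ) (h1 : γ < 1) : Summable (levelLoss γ) := by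
  set r : ℝ := 1 / 2 * 2 ^ γ with hr
  have hr0 : 0 < r := by positivity
  have hr1 : r < 1 := by
    have : (2 : ℝ) ^ γ < 2 ^ (1 : ℝ) := Real.rpow_lt_rpow_of_exponent_lt (by norm_num) h1
    rw [Real.rpow_one] at this
    linarith
  have hsum : Summable fun i : ℕ => r ^ i + (i : ℝ) ^ 3 * r ^ i :=
    (summable_geometric_of_lt_one hr0.le hr1).add
      (summable_pow_mul_geometric_of_norm_lt_one 3 (by rwa [Real.norm_of_nonneg hr0.le]))
  refine Summable.of_nonneg_of_le (levelLoss_nonneg γ) (fun i => ?_)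
    ((summable_nat_add_iff 1).2 hsum)
  have hs := one_le_slowdown (i + 1)
  have hs2 : slowdown (i + 1) ^ γ ≤ 1 + ((i + 1 : ℕ) : ℝ) ^ 3 :=
    ((Real.rpow_le_rpow_of_exponent_le hs h1.le).trans_eq (Real.rpow_one _)).trans
      (slowdown_le (i + 1))
  have h2 : ((2 : ℝ) ^ (i + 1)) ^ γ = (2 ^ γ) ^ (i + 1) := by
    rw [← Real.rpow_natCast, ← Real.rpow_natCast, ← Real.rpow_mul (by norm_num),
      ← Real.rpow_mul (by norm_num), mul_comm]
  unfold levelLoss level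
  rw [Real.mul_rpow (by positivity) (by linarith), h2, ← mul_assoc, ← mul_pow, ← hr]
  have : 0 ≤ r ^ (i + 1) := by positivity
  nlinarith

lemma extend_ofReal (φ : ℝ → ℝ) {t : ℝ} (ht : 0 ≤ t) :
    extend φ (ENNReal.ofReal t) = ENNReal.ofReal (φ t) := by
  rw [extend, if_neg ENNReal.ofReal_ne_top, ENNReal.toReal_ofReal ht]

lemma le_extend_top (φ : ℝ → ℝ) {s : ℝ} (hs : 1 ≤ s) :
    ENNReal.ofReal (φ s) ≤ extend φ ∞ := by
  rw [extend, if_pos rfl]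
  exact le_iSup₂ (f := fun (s : ℝ) (_ : s ∈ Set.Ici 1) => ENNReal.ofReal (φ s)) s hs

lemma le_extend {φ : ℝ → ℝ} (hφ : MonotoneOn φ (Set.Ici 1)) {s : ℝ} {t : ℝ≥0∞} (hs : 1 ≤ s)
    (ht : ENNReal.ofReal s ≤ t) : ENNReal.ofReal (φ s) ≤ extend φ t := by
  rcases eq_or_ne t ∞ with rfl | htop
  · exact le_extend_top φ hs
  · have hst : s ≤ t.toReal := (ENNReal.ofReal_le_iff_le_toReal htop).1 ht
    rw [extend, if_neg htop]
    exact ENNReal.ofReal_le_ofReal (hφ hs (hs.trans hst) hst)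

/-- Pointwise comparison of `φ` at the thresholds `u i`. -/
lemma le_extend_add_tsum {φ : ℝ → ℝ} {γ K m : ℝ} {u : ℕ → ℝ} (hγ : 0 < γ) (hK : 0 ≤ K)
    (h0 : ∀ t, 1 ≤ t → 0 ≤ φ t) (hmono : MonotoneOn φ (Set.Ici 1)) (hm : 1 ≤ m)
    (hφ : ∀ s, 1 ≤ s → s ≤ m → φ m - φ s ≤ K * (φ (2 * m) - φ m) * (m / s) ^ γ)
    (hu0 : 2 * m ≤ u 0) (hu : ∀ i, 0 < u i) (hlim : Filter.Tendsto u Filter.atTop (nhds 0))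
    {t : ℝ≥0∞} (ht : 1 ≤ t) :
    ENNReal.ofReal (φ m) + ENNReal.ofReal (φ (2 * m) - φ m) *
        (Set.Ioi (ENNReal.ofReal (u 0))).indicator 1 t ≤
      extend φ t + ∑' i, ENNReal.ofReal (K * (φ (2 * m) - φ m) * (m / u (i + 1)) ^ γ) *
        (Set.Iic (ENNReal.ofReal (u i))).indicator 1 t := by
  classical
  have hD : 0 ≤ φ (2 * m) - φ m := by
    have := hmono (Set.mem_Ici.2 hm) (Set.mem_Ici.2 (by linarith : 1 ≤ 2 * m)) (by linarith)
    linarith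
  by_cases htu : ENNReal.ofReal (u 0) < t
  · rw [Set.indicator_of_mem (Set.mem_Ioi.2 htu), Pi.one_apply, mul_one,
      ← ENNReal.ofReal_add (h0 m hm) hD, add_sub_cancel]
    exact (le_extend hmono (by linarith)
      ((ENNReal.ofReal_le_ofReal hu0).trans htu.le)).trans le_self_add
  · rw [Set.indicator_of_notMem (by simpa using htu), mul_zero, add_zero]
    have htop : t ≠ ∞ := fun h => htu (h ▸ ENNReal.ofReal_lt_top)
    obtain ⟨s, hs, rfl⟩ : ∃ s : ℝ, 1 ≤ s ∧ t = ENNReal.ofReal s :=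
      ⟨t.toReal, (ENNReal.ofReal_le_iff_le_toReal htop).1 (by simpa using ht),
        (ENNReal.ofReal_toReal htop).symm⟩
    rw [extend_ofReal _ (by linarith)]
    rcases le_total m s with hms | hsm
    · exact (ENNReal.ofReal_le_ofReal (hmono (Set.mem_Ici.2 hm) (Set.mem_Ici.2 hs) hms)).trans
        le_self_add
    -- For `s < m` the whole loss is charged to the single term `i` with `u (i + 1) < s ≤ u i`; such
    -- an `i` exists because `u` tends to `0` and `s ≤ u 0`.
    have hex : ∃ i, u i < s := (hlim.eventually_lt_const (by linarith)).exists
    obtain ⟨i, hi⟩ : ∃ i, Nat.find hex = i + 1 := by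
      refine Nat.exists_eq_succ_of_ne_zero fun h => htu ?_
      have := Nat.find_spec hex
      rw [h] at this
      exact (ENNReal.ofReal_lt_ofReal_iff (by linarith)).2 this
    have hi1 : u (i + 1) < s := hi ▸ Nat.find_spec hex
    have hi2 : s ≤ u i := not_lt.1 (Nat.find_min hex (by omega))
    refine le_trans ?_ (add_le_add_right (ENNReal.le_tsum i) _)
    rw [Set.indicator_of_mem (Set.mem_Iic.2 (ENNReal.ofReal_le_ofReal hi2)), Pi.one_apply, mul_one,
      ← ENNReal.ofReal_add (h0 s hs) (by have := hu (i + 1); positivity)]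
    apply ENNReal.ofReal_le_ofReal
    have h1 : (m / s) ^ γ ≤ (m / u (i + 1)) ^ γ := by
      have := hu (i + 1)
      gcongr
    have h2 := mul_le_mul_of_nonneg_left h1 (mul_nonneg hK hD)
    linarith [hφ s hs hsm]

/-- The threshold below which a run ends with probability at least `q_i`, if the mean is `m`. -/
def threshold (A m : ℝ) (i : ℕ) : ℝ := A * m * (1 / 2) ^ i / slowdown i

lemma threshold_pos {A m : ℝ} (hA : 0 < A) (hm : 0 < m) (i : ℕ) : 0 < threshold A m i := by
  have := one_le_slowdown i
  unfold threshold
  positivity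

lemma tendsto_threshold {A m : ℝ} (hA : 0 < A) (hm : 0 < m) :
    Filter.Tendsto (threshold A m) Filter.atTop (nhds 0) := by
  have h : Filter.Tendsto (fun i : ℕ => A * m * (1 / 2) ^ i) Filter.atTop (nhds (A * m * 0)) :=
    (tendsto_pow_atTop_nhds_zero_of_lt_one (by norm_num) (by norm_num)).const_mul _
  rw [mul_zero] at h
  refine squeeze_zero (fun i => (threshold_pos hA hm i).le) (fun i => ?_) h
  exact div_le_self (by positivity) (one_le_slowdown i)

/-- The scale `m` cancels and `A` factors out, so one choice of `A` works for all means and all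
levels. -/
lemma threshold_rpow_mul_level {A m : ℝ} (hA : 0 < A) (hm : 0 < m) (γ : ℝ) (i : ℕ) :
    (m / threshold A m (i + 1)) ^ γ * level i = (A ^ γ)⁻¹ * levelLoss γ i := by
  have hs : 0 < slowdown (i + 1) := by have := one_le_slowdown (i + 1); linarith
  have h : m / threshold A m (i + 1) = A⁻¹ * (2 ^ (i + 1) * slowdown (i + 1)) := by
    unfold threshold
    rw [one_div, inv_pow]
    field_simp
  rw [h, Real.mul_rpow (by positivity) (by positivity), Real.inv_rpow hA.le, levelLoss]
  ring

/-- If no run is short with the required probability, the mean exceeds `m`. -/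
lemma exists_level_le_measure {φ : ℝ → ℝ} {γ K A m : ℝ} (hγ : 0 < γ) (hγ1 : γ < 1) (hK : 0 ≤ K)
    (h0 : ∀ t, 1 ≤ t → 0 ≤ φ t) (hmono : StrictMonoOn φ (Set.Ici 1)) (hm : 1 ≤ m)
    (hφ : ∀ s, 1 ≤ s → s ≤ m → φ m - φ s ≤ K * (φ (2 * m) - φ m) * (m / s) ^ γ)
    (hA : 2 ≤ A) (hA2 : 2 * K * (∑' i, levelLoss γ i) < A ^ γ)
    (p : Measure ℝ≥0∞) [IsProbabilityMeasure p] (hp : ∀ᵐ t ∂p, 1 ≤ t)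
    (hmean : ∫⁻ t, extend φ t ∂p ≤ ENNReal.ofReal (φ m)) :
    ∃ i, ENNReal.ofReal (level i) ≤ p (Set.Iic (ENNReal.ofReal (threshold A m i))) := by
  by_contra! hlt
  have hA0 : 0 < A := by linarith
  have hm0 : 0 < m := by linarith
  set u := threshold A m with hu
  set D := φ (2 * m) - φ m with hD
  have hDpos : 0 < D := by
    have := hmono (Set.mem_Ici.2 hm) (Set.mem_Ici.2 (by linarith : 1 ≤ 2 * m)) (by linarith)
    linarith
  have hu0 : 2 * m ≤ u 0 := by
    simp only [hu, threshold, slowdown]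
    norm_num
    nlinarith
  have hupos := threshold_pos hA0 hm0
  have hmeas (i : ℕ) : Measurable fun t => ENNReal.ofReal (K * D * (m / u (i + 1)) ^ γ) *
      (Set.Iic (ENNReal.ofReal (u i))).indicator (1 : ℝ≥0∞ → ℝ≥0∞) t :=
    (measurable_one.indicator measurableSet_Iic).const_mul _
  have hterm (i : ℕ) : 0 ≤ K * D * ((A ^ γ)⁻¹ * levelLoss γ i) := by
    have := levelLoss_nonneg γ i
    positivity
  have hleft : ENNReal.ofReal (φ m) + ENNReal.ofReal (D * (1 / 2)) ≤
      ∫⁻ t, (ENNReal.ofReal (φ m) + ENNReal.ofReal D *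
        (Set.Ioi (ENNReal.ofReal (u 0))).indicator 1 t) ∂p := by
    rw [lintegral_add_left measurable_const, lintegral_const, measure_univ, mul_one,
      lintegral_const_mul _ (measurable_one.indicator measurableSet_Ioi),
      lintegral_indicator_one measurableSet_Ioi, ENNReal.ofReal_mul hDpos.le]
    gcongr
    -- The failure at level `0` alone gives `P(T > u 0) ≥ 1 - q_0 = 1/2`.
    rw [← Set.compl_Iic, prob_compl_eq_one_sub measurableSet_Iic]
    refine le_trans ?_ (tsub_le_tsub_left (hlt 0).le 1)
    rw [← ENNReal.ofReal_one, ← ENNReal.ofReal_sub _ (level_pos 0).le]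
    exact ENNReal.ofReal_le_ofReal (by norm_num [level])
  have hright : ∫⁻ t, ∑' i, ENNReal.ofReal (K * D * (m / u (i + 1)) ^ γ) *
      (Set.Iic (ENNReal.ofReal (u i))).indicator 1 t ∂p ≤
        ENNReal.ofReal (K * D * ((A ^ γ)⁻¹ * ∑' i, levelLoss γ i)) := by
    rw [lintegral_tsum fun i => (hmeas i).aemeasurable, ← tsum_mul_left, ← tsum_mul_left,
      ENNReal.ofReal_tsum_of_nonneg hterm (((summable_levelLoss hγ hγ1).mul_left _).mul_left _)]
    refine ENNReal.tsum_le_tsum fun i => ?_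
    rw [lintegral_const_mul _ (measurable_one.indicator measurableSet_Iic),
      lintegral_indicator_one measurableSet_Iic]
    refine (mul_le_mul_right (hlt i).le _).trans_eq ?_
    rw [← ENNReal.ofReal_mul (by have := hupos (i + 1); positivity), mul_assoc (K * D),
      threshold_rpow_mul_level hA0 hm0]
  have hpt := lintegral_mono_ae (hp.mono fun t ht => le_extend_add_tsum hγ hK h0
    hmono.monotoneOn hm hφ hu0 hupos (tendsto_threshold hA0 hm0) ht)
  rw [lintegral_add_right _ (.tsum hmeas)] at hpt
  have h := (hleft.trans hpt).trans (add_le_add hmean hright)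
  -- Cancelling `φ m` and then `D` leaves `A ^ γ / 2 ≤ K * ∑ levelLoss`, against the choice of `A`.
  rw [ENNReal.add_le_add_iff_left ENNReal.ofReal_ne_top, ENNReal.ofReal_le_ofReal_iff (mul_nonneg
    (mul_nonneg hK hDpos.le) (mul_nonneg (by positivity) (tsum_nonneg (levelLoss_nonneg γ)))),
    mul_comm K D, mul_assoc, mul_le_mul_iff_right₀ hDpos, mul_left_comm,
    le_inv_mul_iff₀ (by positivity)] at h
  linarith

/-- The bound of the parallel restart strategy by a generalised mean whose increments near `0`
are dominated by a power with exponent greater than `-1`. -/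
theorem exists_prsTime_le {φ : ℝ → ℝ} {γ K : ℝ} (hγ : 0 < γ) (hγ1 : γ < 1) (hK : 0 ≤ K)
    (h0 : ∀ t, 1 ≤ t → 0 ≤ φ t) (hmono : StrictMonoOn φ (Set.Ici 1))
    (hφ : ∀ m s, 1 ≤ s → s ≤ m → φ m - φ s ≤ K * (φ (2 * m) - φ m) * (m / s) ^ γ) :
    ∃ C : ℝ≥0, 0 < C ∧ ∀ (p : Measure ℝ≥0∞) [IsProbabilityMeasure p], (∀ᵐ t ∂p, 1 ≤ t) →
      ∀ m : ℝ, 1 ≤ m → ∫⁻ t, extend φ t ∂p ≤ ENNReal.ofReal (φ m) →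
        prsTime p ≤ C * ENNReal.ofReal m := by
  obtain ⟨A, hA, hA2⟩ := (((tendsto_rpow_atTop hγ).eventually_gt_atTop
    (2 * K * ∑' i, levelLoss γ i)).and (Filter.eventually_ge_atTop 2)).exists
  -- The summand `1` only serves to make the constant visibly positive.
  refine ⟨slowdownMass.toNNReal * (16 * A).toNNReal + 1, by positivity,
    fun p _ hp m hm hmean => ?_⟩
  obtain ⟨i, hi⟩ := exists_level_le_measure hγ hγ1 hK h0 hmono hm (hφ m) hA2 hA p hp hmean
  -- A threshold below `1` would be undershot with probability `0`, which is less than `q_i`.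
  have hu : 1 ≤ threshold A m i := by
    by_contra! hu
    have : p (Set.Iic (ENNReal.ofReal (threshold A m i))) = 0 := by
      rw [measure_eq_zero_iff_ae_notMem]
      filter_upwards [hp] with t ht hti
      have h1 : (1 : ℝ≥0∞) ≤ ENNReal.ofReal (threshold A m i) := ht.trans hti
      exact absurd (ENNReal.one_le_ofReal.1 h1) (not_le.2 hu)
    rw [this, nonpos_iff_eq_zero, ENNReal.ofReal_eq_zero] at hi
    exact absurd (level_pos i) (not_lt.2 hi)
  refine (prsTime_le_of_quantile p i hu hi).trans ?_
  have hval : slowdown i * (8 * threshold A m i / level i) = 16 * A * m := by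
    have := one_le_slowdown i
    have : slowdown i ≠ 0 := by linarith
    unfold threshold level
    rw [pow_succ]
    field_simp
    norm_num
  rw [hval, ENNReal.ofReal_mul (by linarith), ← mul_assoc]
  gcongr
  rw [ENNReal.coe_add, ENNReal.coe_mul, ENNReal.coe_toNNReal slowdownMass_ne_top]
  exact le_self_add

/-! ### Functions whose derivative decays more slowly than `t ^ (-2)` -/

/-- If `t g'(t) / g(t) > -β` for large `t`, then `t ^ β g(t)` is eventually nondecreasing. -/
lemma monotoneOn_rpow_mul {g h : ℝ → ℝ} {β t₀ : ℝ} (ht₀ : 1 < t₀) (hg : ∀ t, t₀ ≤ t → 0 < g t)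
    (hd : ∀ t, t₀ ≤ t → HasDerivAt g (h t) t) (hβ : ∀ t, t₀ ≤ t → -β ≤ t * h t / g t) :
    MonotoneOn (fun t => t ^ β * g t) (Set.Ici t₀) := by
  have hderiv (t : ℝ) (ht : t₀ ≤ t) :
      HasDerivAt (fun t => t ^ β * g t) (β * t ^ (β - 1) * g t + t ^ β * h t) t :=
    (Real.hasDerivAt_rpow_const (Or.inl (by linarith))).mul (hd t ht)
  refine monotoneOn_of_hasDerivWithinAt_nonneg (convex_Ici t₀)
    (fun t ht => (hderiv t ht).continuousAt.continuousWithinAt)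
    (fun t ht => (hderiv t (interior_subset ht)).hasDerivWithinAt) fun t ht => ?_
  replace ht : t₀ ≤ t := interior_subset ht
  have ht0 : 0 < t := by linarith
  have h1 : t ^ β = t ^ (β - 1) * t := by
    rw [← Real.rpow_add_one ht0.ne', sub_add_cancel]
  have h2 := hβ t ht
  rw [le_div_iff₀ (hg t ht)] at h2
  have h3 : β * t ^ (β - 1) * g t + t ^ β * h t = t ^ (β - 1) * (β * g t + t * h t) := by
    rw [h1]; ring
  rw [h3]
  exact mul_nonneg (Real.rpow_nonneg ht0.le _) (by linarith)

/-- A positive nonincreasing `g` for which `t ^ β g(t)` is eventually nondecreasing is regular on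
the whole half-line up to a constant. -/
lemma rpow_mul_le_of_antitoneOn {g : ℝ → ℝ} {β t₀ : ℝ} (hβ : 0 ≤ β) (ht₀ : 1 ≤ t₀)
    (hg : ∀ t, 1 ≤ t → 0 < g t) (hanti : AntitoneOn g (Set.Ici 1))
    (hmono : MonotoneOn (fun t => t ^ β * g t) (Set.Ici t₀)) {u v : ℝ} (hu : 1 ≤ u) (huv : u ≤ v) :
    u ^ β * g u ≤ g 1 / g t₀ * (v ^ β * g v) := by
  have h1 : g u ≤ g 1 := hanti (Set.mem_Ici.2 le_rfl) (Set.mem_Ici.2 hu) hu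
  have hgt := hg t₀ ht₀
  have hg1 := hg 1 le_rfl
  have hgv := hg v (hu.trans huv)
  have hK : 1 ≤ g 1 / g t₀ := (one_le_div hgt).2
    (hanti (Set.mem_Ici.2 le_rfl) (Set.mem_Ici.2 ht₀) ht₀)
  have hv : 0 < v ^ β := Real.rpow_pos_of_pos (by linarith) _
  rcases le_total t₀ u with htu | hut
  · have h2 := hmono (Set.mem_Ici.2 htu) (Set.mem_Ici.2 (htu.trans huv)) huv
    exact h2.trans (le_mul_of_one_le_left (by positivity) hK)
  · rcases le_total t₀ v with htv | hvt
    · have h2 := hmono (Set.mem_Ici.2 le_rfl) (Set.mem_Ici.2 htv) htv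
      have h3 : u ^ β ≤ t₀ ^ β := Real.rpow_le_rpow (by linarith) hut hβ
      have h4 : 0 < t₀ ^ β := Real.rpow_pos_of_pos (by linarith) _
      calc u ^ β * g u ≤ t₀ ^ β * g 1 := by
            have := hg u hu
            gcongr
        _ = g 1 / g t₀ * (t₀ ^ β * g t₀) := by field_simp
        _ ≤ _ := by gcongr
    · have h2 : g t₀ ≤ g v := hanti (Set.mem_Ici.2 (hu.trans huv)) (Set.mem_Ici.2 ht₀) hvt
      have h3 : u ^ β ≤ v ^ β := Real.rpow_le_rpow (by linarith) huv hβ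
      calc u ^ β * g u ≤ v ^ β * g 1 := by
            have := hg u hu
            gcongr
        _ = g 1 / g t₀ * (v ^ β * g t₀) := by field_simp
        _ ≤ _ := by gcongr

/-- Integrated form of the regularity of the derivative. -/
lemma sub_le_of_rpow_mul_le {φ g : ℝ → ℝ} {β K : ℝ} (hβ : 1 < β)
    (hcont : ContinuousOn φ (Set.Ici 1)) (hd : ∀ t, 1 < t → HasDerivAt φ (g t) t) {m s : ℝ}
    (hK : 0 ≤ K * g m) (hreg : ∀ u, 1 ≤ u → u ≤ m → u ^ β * g u ≤ K * (m ^ β * g m)) (hs : 1 ≤ s) (hsm : s ≤ m) :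
    φ m - φ s ≤ K / (β - 1) * (m * g m) * (m / s) ^ (β - 1) := by
  have hβ1 : 0 < β - 1 := by linarith
  have hs0 : 0 < s := by linarith
  have hm0 : 0 < m := by linarith
  set A := K * (m ^ β * g m) with hA
  have hder (t : ℝ) (ht : 1 < t) : HasDerivAt (fun t => φ t + A / (β - 1) * t ^ (1 - β))
      (g t + A / (β - 1) * ((1 - β) * t ^ (1 - β - 1))) t :=
    (hd t ht).add ((Real.hasDerivAt_rpow_const (Or.inl (by linarith))).const_mul _)
  -- The regularity hypothesis says `g t ≤ A t^{-β}` up to `m`; monotonicity of this auxiliary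
  -- function integrates that bound without requiring `g` to be integrable.
  have hanti : AntitoneOn (fun t => φ t + A / (β - 1) * t ^ (1 - β)) (Set.Icc s m) := by
    refine antitoneOn_of_hasDerivWithinAt_nonpos (convex_Icc s m) ?_
      (f' := fun t => g t + A / (β - 1) * ((1 - β) * t ^ (1 - β - 1))) ?_ ?_
    · refine (hcont.mono fun t ht => hs.trans ht.1).add (continuousOn_const.mul ?_)
      exact continuousOn_id.rpow_const fun t ht => Or.inl (by
        have := ht.1
        simp only [id]
        linarith)
    · intro t ht
      rw [interior_Icc] at ht
      exact (hder t (hs.trans_lt ht.1)).hasDerivWithinAt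
    · intro t ht
      rw [interior_Icc] at ht
      have ht0 : 0 < t := hs0.trans ht.1
      have h1 := hreg t (hs.trans ht.1.le) ht.2.le
      have h2 : A / (β - 1) * ((1 - β) * t ^ (1 - β - 1)) = -(A / t ^ β) := by
        rw [show 1 - β - 1 = -β by ring, Real.rpow_neg ht0.le]
        field_simp
        ring
      have h3 : 0 < t ^ β := Real.rpow_pos_of_pos ht0 _
      rw [h2]
      have h4 : g t ≤ A / t ^ β := by
        rw [le_div_iff₀ h3, mul_comm]
        exact h1
      linarith
  have h := hanti (Set.left_mem_Icc.2 hsm) (Set.right_mem_Icc.2 hsm) hsm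
  simp only at h
  have h1 : s ^ (1 - β) = (s ^ (β - 1))⁻¹ := by rw [← Real.rpow_neg hs0.le, neg_sub]
  have hA0 : A / (β - 1) * s ^ (1 - β) = K / (β - 1) * (m * g m) * (m / s) ^ (β - 1) := by
    rw [Real.div_rpow hm0.le hs0.le, h1, hA]
    have : m ^ β = m ^ (β - 1) * m := by rw [← Real.rpow_add_one hm0.ne', sub_add_cancel]
    rw [this]
    field_simp
  have hAm : 0 ≤ A / (β - 1) * m ^ (1 - β) := by
    have h2 : A = K * g m * m ^ β := by rw [hA]; ring
    rw [h2]
    positivity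
  linarith

/-- The growth condition on a concave function in terms of the second derivative. -/
theorem exists_sub_le_of_liminf {φ : ℝ → ℝ} (hconc : ConcaveOn ℝ (Set.Ici 1) φ)
    (hmono : StrictMonoOn φ (Set.Ici 1)) (hd : DifferentiableOn ℝ φ (Set.Ici 1))
    (hd2 : DifferentiableOn ℝ (derivWithin φ (Set.Ici 1)) (Set.Ici 1))
    (hlim : (-2 : EReal) < Filter.liminf
        (fun t : ℝ => ((t * derivWithin (derivWithin φ (Set.Ici 1)) (Set.Ici 1) t /
          derivWithin φ (Set.Ici 1) t : ℝ) : EReal)) Filter.atTop) :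
    ∃ γ K : ℝ, 0 < γ ∧ γ < 1 ∧ 0 ≤ K ∧ ∀ m s, 1 ≤ s → s ≤ m →
      φ m - φ s ≤ K * (φ (2 * m) - φ m) * (m / s) ^ γ := by
  set g := derivWithin φ (Set.Ici 1) with hg
  set h := derivWithin g (Set.Ici 1) with hh
  have hanti : AntitoneOn g (Set.Ici 1) := hconc.antitoneOn_derivWithin hd
  have hslope {x y : ℝ} (hx : 1 ≤ x) (hxy : x < y) : φ y - φ x ≤ g x * (y - x) := by
    have := hconc.slope_le_derivWithin (Set.mem_Ici.2 hx) (Set.mem_Ici.2 (hx.trans hxy.le)) hxy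
      (hd x hx)
    rwa [slope_def_field, div_le_iff₀ (by linarith)] at this
  have hslope' {x y : ℝ} (hx : 1 ≤ x) (hxy : x < y) : g y * (y - x) ≤ φ y - φ x := by
    have := hconc.derivWithin_le_slope (Set.mem_Ici.2 hx) (Set.mem_Ici.2 (hx.trans hxy.le)) hxy
      (hd y (hx.trans hxy.le))
    rwa [slope_def_field, le_div_iff₀ (by linarith)] at this
  have hpos (t : ℝ) (ht : 1 ≤ t) : 0 < g t := by
    have h1 := hslope ht (lt_add_one t)
    have h2 := hmono (Set.mem_Ici.2 ht) (Set.mem_Ici.2 (by linarith : 1 ≤ t + 1)) (lt_add_one t)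
    linarith
  have hdφ (t : ℝ) (ht : 1 < t) : HasDerivAt φ (g t) t :=
    (hd t ht.le).hasDerivWithinAt.hasDerivAt (Ici_mem_nhds ht)
  have hdg (t : ℝ) (ht : 1 < t) : HasDerivAt g (h t) t :=
    (hd2 t ht.le).hasDerivWithinAt.hasDerivAt (Ici_mem_nhds ht)
  obtain ⟨r, hr1, hr2⟩ := EReal.lt_iff_exists_real_btwn.1 hlim
  have hr1' : -2 < r := by
    rw [show (-2 : EReal) = ((-2 : ℝ) : EReal) from rfl] at hr1
    exact EReal.coe_lt_coe_iff.1 hr1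
  obtain ⟨t₀, ht₀⟩ := Filter.eventually_atTop.1 ((Filter.eventually_lt_of_lt_liminf hr2).and
    (Filter.eventually_gt_atTop 1))
  have ht1 : 1 < t₀ := (ht₀ t₀ le_rfl).2
  -- Any `β ≥ -r` will do. The maximum with `3/2` keeps `γ = β - 1` positive, and `r > -2` keeps it
  -- below `1`.
  set β := max (-r) (3 / 2) with hβ
  have hβ1 : 3 / 2 ≤ β := le_max_right _ _
  have hβ2 : β < 2 := max_lt (by linarith) (by norm_num)
  have hβr : -β ≤ r := by linarith [le_max_left (-r) (3 / 2)]
  have hmon : MonotoneOn (fun t => t ^ β * g t) (Set.Ici t₀) :=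
    monotoneOn_rpow_mul ht1 (fun t ht => hpos t (by linarith)) (fun t ht => hdg t (by linarith))
      fun t ht => hβr.trans (by exact_mod_cast (ht₀ t ht).1.le)
  set K := g 1 / g t₀ with hK
  have hK0 : 0 < K := div_pos (hpos 1 le_rfl) (hpos t₀ ht1.le)
  have hreg {u v : ℝ} (hu : 1 ≤ u) (huv : u ≤ v) : u ^ β * g u ≤ K * (v ^ β * g v) :=
    rpow_mul_le_of_antitoneOn (by linarith) ht1.le hpos hanti hmon hu huv
  -- The first factor comes from integrating the derivative; `K * 2 ^ β` comes from comparing `g m`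
  -- with `g (2 * m)`, which concavity bounds by the increment of `φ` over `[m, 2m]`.
  refine ⟨β - 1, K / (β - 1) * (K * 2 ^ β), by linarith, by linarith,
    by have : 0 < β - 1 := by linarith
       positivity, fun m s hs hsm => ?_⟩
  have hm0 : 0 < m := by linarith
  have hβ0 : 0 < β - 1 := by linarith
  refine (sub_le_of_rpow_mul_le (by linarith) hd.continuousOn hdφ
    (mul_pos hK0 (hpos m (hs.trans hsm))).le (fun u hu hum => hreg hu hum) hs hsm).trans ?_
  have h1 : g m ≤ K * 2 ^ β * g (2 * m) := by
    have := hreg (hs.trans hsm) (by linarith : m ≤ 2 * m)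
    rw [Real.mul_rpow (by norm_num) hm0.le] at this
    have hmβ : 0 < m ^ β := Real.rpow_pos_of_pos hm0 _
    refine le_of_mul_le_mul_left (this.trans_eq ?_) hmβ
    ring
  have h2 : g (2 * m) * m ≤ φ (2 * m) - φ m := by
    have := hslope' (hs.trans hsm) (by linarith : m < 2 * m)
    rwa [show 2 * m - m = m by ring] at this
  have h3 : m * g m ≤ K * 2 ^ β * (φ (2 * m) - φ m) := by
    calc m * g m ≤ m * (K * 2 ^ β * g (2 * m)) := by gcongr
      _ = K * 2 ^ β * (g (2 * m) * m) := by ring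
      _ ≤ _ := by gcongr
  have hs0 : 0 < s := by linarith
  rw [mul_assoc (K / (β - 1)) (K * 2 ^ β)]
  gcongr

/-! ### The generalised mean -/

/-- The integral lies between `φ 1` and the supremum of `φ`. If it equals the supremum, `∞` is a
preimage; otherwise the intermediate value theorem gives a finite one. Thus `Function.invFunOn`
never returns its default value. -/
lemma genMean_spec {φ : ℝ → ℝ} (hmono : MonotoneOn φ (Set.Ici 1))
    (hcont : ContinuousOn φ (Set.Ici 1)) (p : Measure ℝ≥0∞) [IsProbabilityMeasure p]
    (hp : ∀ᵐ t ∂p, 1 ≤ t) :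
    1 ≤ genMean φ p ∧ extend φ (genMean φ p) = ∫⁻ t, extend φ t ∂p := by
  set J := ∫⁻ t, extend φ t ∂p with hJ
  have hlow : ENNReal.ofReal (φ 1) ≤ J := by
    calc ENNReal.ofReal (φ 1) = ∫⁻ _, ENNReal.ofReal (φ 1) ∂p := by simp
      _ ≤ J := lintegral_mono_ae (hp.mono fun t ht => le_extend hmono le_rfl (by simpa using ht))
  have hle (t : ℝ≥0∞) (ht : 1 ≤ t) : extend φ t ≤ extend φ ∞ := by
    rcases eq_or_ne t ∞ with rfl | htop
    · exact le_rfl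
    · rw [← ENNReal.ofReal_toReal htop, extend_ofReal _ ENNReal.toReal_nonneg]
      exact le_extend_top φ ((ENNReal.ofReal_le_iff_le_toReal htop).1 (by simpa using ht))
  have hup : J ≤ extend φ ∞ := by
    calc J ≤ ∫⁻ _, extend φ ∞ ∂p := lintegral_mono_ae (hp.mono hle)
      _ = _ := by simp
  have hex : ∃ x ∈ Set.Icc 1 ∞, extend φ x = J := by
    rcases hup.eq_or_lt with h | h
    · exact ⟨∞, by simp, h.symm⟩
    · obtain ⟨s, hs, hJs⟩ : ∃ s : ℝ, 1 ≤ s ∧ J < ENNReal.ofReal (φ s) := by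
        rw [extend, if_pos rfl] at h
        simpa only [lt_iSup_iff, Set.mem_Ici, exists_prop] using h
      have hcs : ContinuousOn (fun t => ENNReal.ofReal (φ t)) (Set.Icc 1 s) :=
        ENNReal.continuous_ofReal.comp_continuousOn (hcont.mono fun t ht => ht.1)
      obtain ⟨x, hx, hxJ⟩ := intermediate_value_Icc hs hcs ⟨hlow, hJs.le⟩
      refine ⟨ENNReal.ofReal x, ⟨by simpa using hx.1, le_top⟩, ?_⟩
      rw [extend_ofReal _ (by linarith [hx.1])]
      exact hxJ
  exact ⟨(Function.invFunOn_mem hex).1, Function.invFunOn_eq hex⟩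

theorem exists_prsTime_le_genMean {φ : ℝ → ℝ} {γ K : ℝ} (hγ : 0 < γ) (hγ1 : γ < 1) (hK : 0 ≤ K)
    (h0 : ∀ t, 1 ≤ t → 0 ≤ φ t) (hmono : StrictMonoOn φ (Set.Ici 1))
    (hcont : ContinuousOn φ (Set.Ici 1))
    (hφ : ∀ m s, 1 ≤ s → s ≤ m → φ m - φ s ≤ K * (φ (2 * m) - φ m) * (m / s) ^ γ) :
    ∃ C : ℝ≥0, 0 < C ∧ ∀ (p : Measure ℝ≥0∞) [IsProbabilityMeasure p], (∀ᵐ t ∂p, 1 ≤ t) →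
      prsTime p ≤ C * genMean φ p := by
  obtain ⟨C, hC, h⟩ := exists_prsTime_le hγ hγ1 hK h0 hmono hφ
  refine ⟨C, hC, fun p _ hp => ?_⟩
  obtain ⟨h1, h2⟩ := genMean_spec hmono.monotoneOn hcont p hp
  rcases eq_or_ne (genMean φ p) ∞ with htop | htop
  · rw [htop, ENNReal.mul_top (by exact_mod_cast hC.ne')]
    exact le_top
  · have hm := ENNReal.ofReal_toReal htop
    rw [← hm]
    refine h p hp _ ((ENNReal.ofReal_le_iff_le_toReal htop).1 (by simpa using h1)) ?_
    rw [← h2, ← extend_ofReal _ ENNReal.toReal_nonneg, hm]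

/-! ### Logarithm and powers -/

/-- Here `φ (2m) - φ m = log 2` is constant, and `log x ≤ 2 x^(1/2)` gives the loss estimate with `γ
= 1/2`. -/
theorem exists_prsTime_le_exp_log :
    ∃ C : ℝ≥0, 0 < C ∧ ∀ (p : Measure ℝ≥0∞) [IsProbabilityMeasure p], (∀ᵐ t ∂p, 1 ≤ t) →
      prsTime p ≤ C * EReal.exp ((∫⁻ t, (ENNReal.log t).toENNReal ∂p : ℝ≥0∞) : EReal) := by
  have hlog2 : 0 < Real.log 2 := Real.log_pos (by norm_num)
  obtain ⟨C, hC, h⟩ := exists_prsTime_le (φ := Real.log) (γ := 1 / 2) (K := 2 / Real.log 2)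
    (by norm_num) (by norm_num) (by positivity) (fun t ht => Real.log_nonneg ht)
    (Real.strictMonoOn_log.mono fun t ht => lt_of_lt_of_le (one_pos (α := ℝ)) ht) (fun m s hs hsm => by
      have hs0 : 0 < s := by linarith
      have hm0 : 0 < m := by linarith
      rw [← Real.log_div hm0.ne' hs0.ne', ← Real.log_div (by positivity) hm0.ne',
        mul_div_cancel_right₀ _ hm0.ne', div_mul_cancel₀ _ hlog2.ne']
      refine (Real.log_le_rpow_div (by positivity) (ε := 1 / 2) (by norm_num)).trans_eq ?_
      ring)
  refine ⟨C, hC, fun p _ hp => ?_⟩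
  set L := ∫⁻ t, (ENNReal.log t).toENNReal ∂p with hL
  rcases eq_or_ne L ∞ with htop | htop
  · rw [htop, EReal.coe_ennreal_top, EReal.exp_top, ENNReal.mul_top (by exact_mod_cast hC.ne')]
    exact le_top
  · have hLr : ((L : ℝ≥0∞) : EReal) = ((L.toReal : ℝ) : EReal) :=
      (EReal.coe_toReal (by simpa using htop) (by simp)).symm.trans (by simp)
    rw [hLr, EReal.exp_coe]
    refine h p hp _ (Real.one_le_exp ENNReal.toReal_nonneg) ?_
    rw [Real.log_exp, ENNReal.ofReal_toReal htop]
    refine lintegral_mono_ae (hp.mono fun t ht => ?_)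
    rcases eq_or_ne t ∞ with rfl | ht'
    · simp
    · have ht1 : 1 ≤ t.toReal := (ENNReal.ofReal_le_iff_le_toReal ht').1 (by simpa using ht)
      rw [extend, if_neg ht', ENNReal.log_pos_real' (by linarith)]
      exact le_of_eq (by simp [EReal.toENNReal_of_ne_top])

/-- The whole loss is at most `m^a`, already a multiple of `(2m)^a - m^a`, so any `γ` in `(0, 1)`
would serve. -/
theorem exists_prsTime_le_rpow_of_pos {a : ℝ} (ha : 0 < a) :
    ∃ C : ℝ≥0, 0 < C ∧ ∀ (p : Measure ℝ≥0∞) [IsProbabilityMeasure p], (∀ᵐ t ∂p, 1 ≤ t) →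
      prsTime p ≤ C * (∫⁻ t, t ^ a ∂p) ^ (1 / a) := by
  have h2a : 1 < (2 : ℝ) ^ a := Real.one_lt_rpow (by norm_num) ha
  obtain ⟨C, hC, h⟩ := exists_prsTime_le (φ := fun t => t ^ a) (γ := 1 / 2) (K := 1 / (2 ^ a - 1))
    (by norm_num) (by norm_num) (one_div_nonneg.2 (by linarith))
    (fun t ht => Real.rpow_nonneg (by linarith) _)
    (fun s hs t _ hst => Real.rpow_lt_rpow (by linarith [Set.mem_Ici.1 hs]) hst ha)
    (fun m s hs hsm => by
      have hs0 : 0 < s := by linarith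
      have hm0 : 0 < m := by linarith
      have h1 : (1 : ℝ) ≤ (m / s) ^ (1 / 2 : ℝ) :=
        Real.one_le_rpow ((one_le_div hs0).2 hsm) (by norm_num)
      have h2 : 0 < s ^ a := Real.rpow_pos_of_pos hs0 _
      have h3 : 0 < m ^ a := Real.rpow_pos_of_pos hm0 _
      have h4 : (2 : ℝ) ^ a - 1 ≠ 0 := by linarith
      rw [Real.mul_rpow (by norm_num) hm0.le, ← sub_one_mul, ← mul_assoc, one_div_mul_cancel h4,
        one_mul]
      nlinarith)
  refine ⟨C, hC, fun p _ hp => ?_⟩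
  set J := ∫⁻ t, t ^ a ∂p with hJ
  have hJ1 : 1 ≤ J := by
    calc (1 : ℝ≥0∞) = ∫⁻ _, 1 ∂p := by simp
      _ ≤ J := lintegral_mono_ae (hp.mono fun t ht => ENNReal.one_le_rpow ht ha)
  rcases eq_or_ne J ∞ with htop | htop
  · rw [htop, ENNReal.top_rpow_of_pos (by positivity), ENNReal.mul_top (by exact_mod_cast hC.ne')]
    exact le_top
  · have hJr : 1 ≤ J.toReal := (ENNReal.ofReal_le_iff_le_toReal htop).1 (by simpa using hJ1)
    rw [← ENNReal.ofReal_toReal htop, ENNReal.ofReal_rpow_of_pos (by linarith)]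
    refine h p hp _ (Real.one_le_rpow hJr (by positivity)) ?_
    rw [← Real.rpow_mul (by linarith), one_div_mul_cancel ha.ne', Real.rpow_one,
      ENNReal.ofReal_toReal htop]
    refine lintegral_mono fun t => ?_
    rcases eq_or_ne t ∞ with rfl | ht
    · simp [ENNReal.top_rpow_of_pos ha]
    · rw [extend, if_neg ht, ← ENNReal.ofReal_rpow_of_nonneg ENNReal.toReal_nonneg ha.le,
        ENNReal.ofReal_toReal ht]

/-- With `φ = 1 - t^a` the loss is at most `s^a = m^a (m/s)^(-a)`, so `γ = -a`; this is where `a >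
-1` is needed. -/
theorem exists_prsTime_le_rpow_of_neg {a : ℝ} (ha : a < 0) (ha1 : -1 < a) :
    ∃ C : ℝ≥0, 0 < C ∧ ∀ (p : Measure ℝ≥0∞) [IsProbabilityMeasure p], (∀ᵐ t ∂p, 1 ≤ t) →
      prsTime p ≤ C * (∫⁻ t, t ^ a ∂p) ^ (1 / a) := by
  have h2a : (2 : ℝ) ^ a < 1 := Real.rpow_lt_one_of_one_lt_of_neg (by norm_num) ha
  have hle1 (t : ℝ) (ht : 1 ≤ t) : t ^ a ≤ 1 := Real.rpow_le_one_of_one_le_of_nonpos ht ha.le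
  obtain ⟨C, hC, h⟩ := exists_prsTime_le (φ := fun t => 1 - t ^ a) (γ := -a)
    (K := 1 / (1 - 2 ^ a)) (by linarith) (by linarith) (one_div_nonneg.2 (by linarith))
    (fun t ht => by linarith [hle1 t ht])
    (fun s hs t _ hst => by
      have := Real.rpow_lt_rpow_of_neg (lt_of_lt_of_le one_pos hs) hst ha
      simp only
      linarith)
    (fun m s hs hsm => by
      have hs0 : 0 < s := by linarith
      have hm0 : 0 < m := by linarith
      have h3 : 0 < m ^ a := Real.rpow_pos_of_pos hm0 _
      have h4 : 1 - (2 : ℝ) ^ a ≠ 0 := by linarith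
      have h5 : 1 - (2 * m) ^ a - (1 - m ^ a) = (1 - 2 ^ a) * m ^ a := by
        rw [Real.mul_rpow (by norm_num) hm0.le]; ring
      have h6 : m ^ a * (m / s) ^ (-a) = s ^ a := by
        rw [Real.div_rpow hm0.le hs0.le, Real.rpow_neg hm0.le, Real.rpow_neg hs0.le]
        field_simp
      rw [h5, ← mul_assoc, one_div_mul_cancel h4, one_mul, h6]
      linarith)
  refine ⟨C, hC, fun p _ hp => ?_⟩
  set J := ∫⁻ t, t ^ a ∂p with hJ
  have hmeas : Measurable fun t : ℝ≥0∞ => t ^ a := by fun_prop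
  -- Pointwise `φ(t) + t^a ≤ 1`, also at `∞`, where `t^a = 0` and `φ` is a supremum of values at
  -- most `1`.
  have hsum : ∫⁻ t, extend (fun t => 1 - t ^ a) t ∂p + J ≤ 1 := by
    rw [hJ, ← lintegral_add_right _ hmeas]
    calc _ ≤ ∫⁻ _, 1 ∂p := lintegral_mono_ae (hp.mono fun t ht => ?_)
      _ = 1 := by simp
    rcases eq_or_ne t ∞ with rfl | ht'
    · rw [ENNReal.top_rpow_of_neg ha, add_zero, extend, if_pos rfl]
      refine iSup₂_le fun s hs => ?_
      rw [← ENNReal.ofReal_one]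
      exact ENNReal.ofReal_le_ofReal (by
        have : 0 ≤ s ^ a := Real.rpow_nonneg (zero_le_one.trans hs) _
        linarith)
    · have ht1 : 1 ≤ t.toReal := (ENNReal.ofReal_le_iff_le_toReal ht').1 (by simpa using ht)
      nth_rewrite 2 [← ENNReal.ofReal_toReal ht']
      rw [extend, if_neg ht', ENNReal.ofReal_rpow_of_pos (by linarith), ← ENNReal.ofReal_add
        (by linarith [hle1 _ ht1]) (Real.rpow_nonneg (by linarith) _), sub_add_cancel,
        ENNReal.ofReal_one]
  have hJ1 : J ≤ 1 := le_add_self.trans hsum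
  have htop : J ≠ ∞ := (hJ1.trans_lt ENNReal.one_lt_top).ne
  rcases eq_or_ne J 0 with hJ0 | hJ0
  · rw [hJ0, ENNReal.zero_rpow_of_neg (one_div_neg.2 ha),
      ENNReal.mul_top (by exact_mod_cast hC.ne')]
    exact le_top
  · have hJr : 0 < J.toReal := ENNReal.toReal_pos hJ0 htop
    have hJr1 : J.toReal ≤ 1 := ENNReal.toReal_le_of_le_ofReal (by norm_num) (by simpa using hJ1)
    rw [← ENNReal.ofReal_toReal htop, ENNReal.ofReal_rpow_of_pos hJr]
    refine h p hp _ (Real.one_le_rpow_of_pos_of_le_one_of_nonpos hJr hJr1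
      (one_div_neg.2 ha).le) ?_
    rw [← Real.rpow_mul hJr.le, one_div_mul_cancel ha.ne, Real.rpow_one,
      ENNReal.ofReal_sub _ hJr.le, ENNReal.ofReal_one, ENNReal.ofReal_toReal htop]
    exact ENNReal.le_sub_of_add_le_right htop hsum

end Restart

end

theorem mainTheorem1 :
    -- the sufficient condition
    (∀ φ : ℝ → ℝ,
      (∀ t ∈ Set.Ici (1 : ℝ), 0 ≤ φ t) →
      ConcaveOn ℝ (Set.Ici 1) φ →
      StrictMonoOn φ (Set.Ici 1) →
      DifferentiableOn ℝ φ (Set.Ici 1) →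
      DifferentiableOn ℝ (derivWithin φ (Set.Ici 1)) (Set.Ici 1) →
      (-2 : EReal) < Filter.liminf
        (fun t : ℝ => ((t * derivWithin (derivWithin φ (Set.Ici 1)) (Set.Ici 1) t /
          derivWithin φ (Set.Ici 1) t : ℝ) : EReal)) Filter.atTop →
      ∃ C : ℝ≥0, 0 < C ∧ ∀ (p : Measure ℝ≥0∞) [IsProbabilityMeasure p], (∀ᵐ t ∂p, 1 ≤ t) →
        Restart.prsTime p ≤ C * Restart.genMean φ p) ∧
    -- the bound by `exp (𝔼[ln T])`
    (∃ C : ℝ≥0, 0 < C ∧ ∀ (p : Measure ℝ≥0∞) [IsProbabilityMeasure p], (∀ᵐ t ∂p, 1 ≤ t) →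
      Restart.prsTime p ≤
        C * EReal.exp ((∫⁻ t, (ENNReal.log t).toENNReal ∂p : ℝ≥0∞) : EReal)) ∧
    -- the bound by `𝔼[T ^ a] ^ (1 / a)`
    (∀ a : ℝ, -1 < a → a ≠ 0 →
      ∃ C : ℝ≥0, 0 < C ∧ ∀ (p : Measure ℝ≥0∞) [IsProbabilityMeasure p], (∀ᵐ t ∂p, 1 ≤ t) →
        Restart.prsTime p ≤ C * (∫⁻ t, t ^ a ∂p) ^ (1 / a)) := by
  refine ⟨fun φ h0 hconc hmono hd hd2 hlim => ?_, Restart.exists_prsTime_le_exp_log,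
    fun a ha ha0 => ?_⟩
  · obtain ⟨γ, K, hγ, hγ1, hK, hφ⟩ := Restart.exists_sub_le_of_liminf hconc hmono hd hd2 hlim
    exact Restart.exists_prsTime_le_genMean hγ hγ1 hK h0 hmono hd.continuousOn hφ
  · rcases ha0.lt_or_gt with h | h
    · exact Restart.exists_prsTime_le_rpow_of_neg h ha
    · exact Restart.exists_prsTime_le_rpow_of_pos h
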